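/- Let $d\ge 1$, $\lambda=(\lambda_1,\dots,\lambda_d)\in\mathbb R^d$, $\tau=(\tau_1,\dots,\tau_d)\in\mathbb R^d$, and for $r>0$ define the Fisher–Bingham integral $$f(\lambda,\tau,r)=\int_{S^{d-1}(r)}\exp\Bigl(\sum_{i=1}^d\lambda_i t_i^2+\sum_{i=1}^d\tau_i t_i\Bigr)\,d\mathbf t,$$ where $S^{d-1}(r)=\{\mathbf t\in\mathbb R^d: t_1^2+\dots+t_d^2=r^2\}$ and $d\mathbf t$ is the surface measure of $S^{d-1}(r)$, of total mass $r^{d-1}\,2\pi^{d/2}/\Gamma(d/2)$. Suppose that $0>\lambda_1>\lambda_2\ge\dots\ge\lambda_d$ (for $d=1$: $0>\lambda_1$). Then, for every $r>0$, the partial derivatives of $f$ with respect to each $\lambda_j$ and each $\tau_j$ exist at $(\lambda,\tau)$, and, with $\lambda,\tau$ fixed, as $r\to\infty$, $$f(\lambda,\tau,r)=\frac{\pi^{(d-1)/2}}{\prod_{i=2}^d(\lambda_1-\lambda_i)^{1/2}}\,(e^{r\tau_1}+e^{-r\tau_1})\exp\Bigl(r^2\lambda_1-\sum_{i=2}^d\frac{\tau_i^2}{4(\lambda_i-\lambda_1)}\Bigr)(1+o(1)),$$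 $$\partial_{\lambda_1}f(\lambda,\tau,r)=r^2f(\lambda,\tau,r)(1+o(1)),$$ $$\partial_{\lambda_j}f(\lambda,\tau,r)=\Bigl\{\Bigl(\frac{\tau_j}{2(\lambda_j-\lambda_1)}\Bigr)^2+\frac1{2(\lambda_1-\lambda_j)}\Bigr\}f(\lambda,\tau,r)(1+o(1)),\quad j=2,\dots,d,$$ $$\partial_{\tau_1}f(\lambda,\tau,r)=r\,\frac{e^{r\tau_1}-e^{-r\tau_1}}{e^{r\tau_1}+e^{-r\tau_1}}\,f(\lambda,\tau,r)(1+o(1)),$$ $$\partial_{\tau_j}f(\lambda,\tau,r)=\frac{\tau_j}{2(\lambda_1-\lambda_j)}\,f(\lambda,\tau,r)(1+o(1)),\quad j=2,\dots,d.$$ Where a coefficient on the right vanishes ($\tau_1=0$ or $\tau_j=0$), the corresponding formula means that the derivative is $0$ for all sufficiently large $r$. -/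

import Mathlib

open MeasureTheory

/-- The surface measure (volume element) of the sphere of radius `r > 0` centred at the origin of
`ℝ^(n+1)`, as a measure on the ambient space: the surface measure of the unit sphere, transported
by `u ↦ r • u` and multiplied by `r ^ n`. -/
noncomputable def sphereSurfaceMeasure (n : ℕ) (r : ℝ) :
    Measure (EuclideanSpace ℝ (Fin (n + 1))) :=
  ENNReal.ofReal (r ^ n) •
    ((volume : Measure (EuclideanSpace ℝ (Fin (n + 1)))).toSphere).map
      (fun u : Metric.sphere (0 : EuclideanSpace ℝ (Fin (n + 1))) 1 =>
        r • (u : EuclideanSpace ℝ (Fin (n + 1))))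

/-- The Fisher–Bingham integral over the sphere of radius `r` in dimension `d = n + 1`. -/
noncomputable def fisherBingham {n : ℕ} (lam tau : Fin (n + 1) → ℝ) (r : ℝ) : ℝ :=
  ∫ t, Real.exp (∑ i, lam i * t i ^ 2 + ∑ i, tau i * t i) ∂(sphereSurfaceMeasure n r)

/-- The partial derivative of the Fisher–Bingham integral with respect to `lam j`. -/
noncomputable def fisherBinghamDerivLam {n : ℕ} (j : Fin (n + 1)) (lam tau : Fin (n + 1) → ℝ)
    (r : ℝ) : ℝ :=
  deriv (fun x => fisherBingham (Function.update lam j x) tau r) (lam j)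

/-- The partial derivative of the Fisher–Bingham integral with respect to `tau j`. -/
noncomputable def fisherBinghamDerivTau {n : ℕ} (j : Fin (n + 1)) (lam tau : Fin (n + 1) → ℝ)
    (r : ℝ) : ℝ :=
  deriv (fun x => fisherBingham lam (Function.update tau j x) r) (tau j)

/-!
Over each pole `(±r, 0)` the hemisphere is parametrised by the inverse gnomonic projection
`z ↦ k • (±r, z)`, where `k = 1 / √(1 + ‖z / r‖²)`, with surface element `k ^ (n + 1) dz`. On the
sphere `λ₀ t₀²` equals `λ₀ (r² - ∑ tᵢ²)`, so the density at this point is its value at the pole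
times a Gaussian weight in `k • z` with coefficients `λᵢ - λ₀ < 0`, times the factor
`exp (±τ₀ (k - 1) r)`, which tends to `1`. The inequalities `|(k - 1) r| ≤ ‖k • z‖` and
`k ≤ (1 + ‖k • z‖²) / √(1 + ‖z‖²)` bound the integrand by a multiple of the integrable function
`(1 + ‖z‖²) ^ (-(n + 1) / 2)` that does not depend on `r`, so dominated convergence gives the limit
at each pole. Adding the two poles produces `exp (r τ₀) ± exp (-r τ₀)`, and the derivatives of the
integral are moments of the density, so that each ratio to the integral is a moment of the limiting
Gaussian. When `τⱼ = 0` the first moment in the direction `j` vanishes by reflection.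
-/

section UnitSphere

open Metric Set
open scoped Pointwise ENNReal

variable {E : Type*} [NormedAddCommGroup E] [NormedSpace ℝ E]

lemma mem_Ioo_smul_coe_image_preimage_iff {B : Set E} {v : E} :
    v ∈ Ioo (0 : ℝ) 1 • ((↑) '' ((↑) ⁻¹' B : Set (sphere (0 : E) 1)) : Set E) ↔
      v ≠ 0 ∧ v ∈ ball 0 1 ∧ ‖v‖⁻¹ • v ∈ B := by
  rw [mem_ball_zero_iff]
  constructor
  · rintro ⟨c, ⟨hc0, hc1⟩, _, ⟨u, hu, rfl⟩, rfl⟩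
    have hnorm : ‖c • (u : E)‖ = c := by simp [norm_smul, abs_of_pos hc0]
    simp only [hnorm]
    refine ⟨norm_pos_iff.1 (hnorm.symm ▸ hc0), hc1, ?_⟩
    rwa [inv_smul_smul₀ hc0.ne']
  · rintro ⟨h0, h1, hB⟩
    have hpos := norm_pos_iff.2 h0
    refine ⟨‖v‖, ⟨hpos, h1⟩, ‖v‖⁻¹ • v, ⟨⟨‖v‖⁻¹ • v, ?_⟩, hB, rfl⟩, smul_inv_smul₀ hpos.ne' v⟩
    simp [norm_smul, hpos.ne']

lemma lintegral_Ioo_ofReal_pow (n : ℕ) {k : ℝ} (hk : 0 ≤ k) :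
    ∫⁻ s in Ioo 0 k, ENNReal.ofReal (s ^ n) = ENNReal.ofReal (k ^ (n + 1) / (n + 1)) := by
  rw [setLIntegral_congr Ioo_ae_eq_Ioc, ← ofReal_integral_eq_lintegral_ofReal,
    ← intervalIntegral.integral_of_le hk, integral_pow]
  · simp
  · exact (continuous_pow n).integrableOn_Ioc
  · filter_upwards [ae_restrict_mem measurableSet_Ioc] with s hs
    exact pow_nonneg hs.1.le n

lemma lintegral_eq_lintegral_Ioi_add_neg (F : ℝ → ℝ≥0∞) :
    ∫⁻ s, F s = (∫⁻ s in Ioi 0, F s) + ∫⁻ s in Ioi 0, F (-s) := by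
  rw [← lintegral_add_compl F measurableSet_Ioi (A := Ioi (0 : ℝ)), compl_Ioi,
    ← setLIntegral_congr Iio_ae_eq_Iic]
  congr 1
  rw [← (Measure.measurePreserving_neg volume).setLIntegral_comp_preimage_emb
    (MeasurableEquiv.neg ℝ).measurableEmbedding]
  simp

lemma lintegral_Ioi_pow_mul_indicator_ball (n : ℕ) (G : E → ℝ≥0∞) {p : E} (hp : p ≠ 0) :
    ∫⁻ s in Ioi (0 : ℝ), ENNReal.ofReal (|s| ^ n) *
        (ball 0 1).indicator (fun v => G (‖v‖⁻¹ • v)) (s • p) =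
      ENNReal.ofReal (‖p‖⁻¹ ^ (n + 1) / (n + 1)) * G (‖p‖⁻¹ • p) := by
  have hp0 : 0 < ‖p‖ := norm_pos_iff.2 hp
  have hray : ∀ s ∈ Ioi (0 : ℝ), ENNReal.ofReal (|s| ^ n) *
      (ball 0 1).indicator (fun v => G (‖v‖⁻¹ • v)) (s • p) =
      (Iio ‖p‖⁻¹).indicator (fun s => ENNReal.ofReal (s ^ n) * G (‖p‖⁻¹ • p)) s := by
    intro s (hs : 0 < s)
    have hnorm : ‖s • p‖ = s * ‖p‖ := by rw [norm_smul, Real.norm_of_nonneg hs.le]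
    have hmem : s • p ∈ ball (0 : E) 1 ↔ s ∈ Iio ‖p‖⁻¹ := by
      rw [mem_ball_zero_iff, hnorm, ← lt_div_iff₀ hp0, one_div, mem_Iio]
    have hdir : ‖s • p‖⁻¹ • s • p = ‖p‖⁻¹ • p := by
      rw [hnorm, smul_smul, mul_inv_rev, inv_mul_cancel_right₀ hs.ne']
    simp only [indicator, hmem, hdir, abs_of_pos hs]
    split_ifs <;> simp
  rw [setLIntegral_congr_fun measurableSet_Ioi hray, setLIntegral_indicator measurableSet_Iio,
    Iio_inter_Ioi, lintegral_mul_const _ (by fun_prop), lintegral_Ioo_ofReal_pow n (by positivity)]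

lemma lintegral_pow_mul_indicator_ball (n : ℕ) (G : E → ℝ≥0∞) {p : E} (hp : p ≠ 0) :
    ∫⁻ s : ℝ, ENNReal.ofReal (|s| ^ n) * (ball 0 1).indicator (fun v => G (‖v‖⁻¹ • v)) (s • p) =
      ENNReal.ofReal (‖p‖⁻¹ ^ (n + 1) / (n + 1)) * (G (‖p‖⁻¹ • p) + G (-(‖p‖⁻¹ • p))) := by
  have hneg := lintegral_Ioi_pow_mul_indicator_ball n G (neg_ne_zero.2 hp)
  rw [norm_neg, smul_neg] at hneg
  rw [lintegral_eq_lintegral_Ioi_add_neg, lintegral_Ioi_pow_mul_indicator_ball n G hp, mul_add,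
    ← hneg]
  simp only [abs_neg, neg_smul, smul_neg]

variable [MeasurableSpace E] [BorelSpace E]

lemma measurable_norm_inv_smul [SecondCountableTopology E] :
    Measurable fun v : E => ‖v‖⁻¹ • v :=
  measurable_norm.inv.smul measurable_id

lemma map_coe_toSphere [SecondCountableTopology E] (μ : Measure E) [NullSingletonClass μ] :
    μ.toSphere.map (↑) = (Module.finrank ℝ E : ℝ≥0∞) •
      (μ.restrict (ball 0 1)).map fun v => ‖v‖⁻¹ • v := by
  ext B hB
  have hcone : (Ioo (0 : ℝ) 1 • ((↑) '' ((↑) ⁻¹' B : Set (sphere (0 : E) 1)) : Set E)) =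
      ((fun v => ‖v‖⁻¹ • v) ⁻¹' B ∩ ball 0 1) \ {0} := by
    ext v
    rw [mem_Ioo_smul_coe_image_preimage_iff]
    simp only [mem_sdiff, mem_inter_iff, mem_preimage, mem_singleton_iff]
    tauto
  rw [Measure.map_apply measurable_subtype_coe hB,
    μ.toSphere_apply' (measurable_subtype_coe hB), hcone,
    measure_sdiff_null (measure_singleton 0), Measure.smul_apply, smul_eq_mul,
    Measure.map_apply measurable_norm_inv_smul hB,
    Measure.restrict_apply (measurable_norm_inv_smul hB)]

lemma measurePreserving_map_coe_toSphere [SecondCountableTopology E]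
    {μ : Measure E} [NullSingletonClass μ] {e : E ≃ₗᵢ[ℝ] E} (he : MeasurePreserving e μ μ) :
    MeasurePreserving e (μ.toSphere.map (↑)) (μ.toSphere.map (↑)) := by
  refine ⟨he.measurable, ?_⟩
  have hball : MeasurePreserving e (μ.restrict (ball 0 1)) (μ.restrict (ball 0 1)) := by
    simpa using he.restrict_preimage (measurableSet_ball (x := (0 : E)) (ε := 1))
  have hcomm : e ∘ (fun v => ‖v‖⁻¹ • v) = (fun v => ‖v‖⁻¹ • v) ∘ e := by
    ext v
    simp
  rw [map_coe_toSphere, Measure.map_smul, Measure.map_map he.measurable measurable_norm_inv_smul,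
    hcomm, ← Measure.map_map measurable_norm_inv_smul he.measurable, hball.map_eq]

lemma lintegral_eq_mul_lintegral_comp_smul [FiniteDimensional ℝ E] {μ : Measure E}
    [μ.IsAddHaarMeasure] (F : E → ℝ≥0∞) {s : ℝ} (hs : s ≠ 0) :
    ∫⁻ v, F v ∂μ = ENNReal.ofReal (|s| ^ Module.finrank ℝ E) * ∫⁻ v, F (s • v) ∂μ := by
  have hemb : MeasurableEmbedding fun v : E => s • v :=
    (Homeomorph.smulOfNeZero s hs).measurableEmbedding
  rw [← hemb.lintegral_map, Measure.map_addHaar_smul μ hs, lintegral_smul_measure, smul_eq_mul,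
    ← mul_assoc, ← ENNReal.ofReal_mul (by positivity), abs_inv, abs_pow,
    mul_inv_cancel₀ (by positivity), ENNReal.ofReal_one, one_mul]

lemma integrable_map_coe_toSphere [FiniteDimensional ℝ E] (μ : Measure E) [μ.IsAddHaarMeasure]
    {g : E → ℝ} (hg : Continuous g) : Integrable g (μ.toSphere.map (↑)) := by
  rw [integrable_map_measure hg.aestronglyMeasurable (by fun_prop)]
  exact (hg.comp continuous_subtype_val).integrable_of_hasCompactSupport (.of_compactSpace _)

end UnitSphere

section Gnomonic

open Metric Set
open scoped ENNReal

variable {n : ℕ}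

/-- The point of `ℝ^(n+1)` with first coordinate `s` and remaining coordinates `z`. -/
noncomputable def consVec (s : ℝ) (z : EuclideanSpace ℝ (Fin n)) :
    EuclideanSpace ℝ (Fin (n + 1)) :=
  WithLp.toLp 2 (Fin.cons s z.ofLp)

/-- The last `n` coordinates of a point of `ℝ^(n+1)`: the tangential part at the poles `(±r, 0)`. -/
noncomputable def tailVec (t : EuclideanSpace ℝ (Fin (n + 1))) : EuclideanSpace ℝ (Fin n) :=
  WithLp.toLp 2 (Fin.tail t.ofLp)

/-- The factor `‖(1, z)‖⁻¹` which projects the point `(1, z)` radially onto the unit sphere. -/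
noncomputable def gnomonicScale (z : EuclideanSpace ℝ (Fin n)) : ℝ :=
  (√(1 + ‖z‖ ^ 2))⁻¹

/-- The inverse gnomonic projection: the point of the upper unit hemisphere on the ray through
`(1, z)`. -/
noncomputable def gnomonicPoint (z : EuclideanSpace ℝ (Fin n)) : EuclideanSpace ℝ (Fin (n + 1)) :=
  gnomonicScale z • consVec 1 z

/-- The surface measure of the upper unit hemisphere, read in gnomonic coordinates. -/
noncomputable def gnomonicMeasure (n : ℕ) : Measure (EuclideanSpace ℝ (Fin n)) :=
  volume.withDensity fun z => ENNReal.ofReal (gnomonicScale z ^ (n + 1))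

@[simp]
lemma consVec_zero (s : ℝ) (z : EuclideanSpace ℝ (Fin n)) : consVec s z 0 = s := rfl

@[simp]
lemma consVec_succ (s : ℝ) (z : EuclideanSpace ℝ (Fin n)) (i : Fin n) :
    consVec s z i.succ = z i := rfl

@[simp]
lemma tailVec_apply (t : EuclideanSpace ℝ (Fin (n + 1))) (i : Fin n) :
    tailVec t i = t i.succ := rfl

@[simp]
lemma tailVec_consVec (s : ℝ) (z : EuclideanSpace ℝ (Fin n)) : tailVec (consVec s z) = z := rfl

lemma smul_consVec (c s : ℝ) (z : EuclideanSpace ℝ (Fin n)) :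
    c • consVec s z = consVec (c * s) (c • z) := by
  ext i
  cases i using Fin.cases <;> simp

lemma consVec_ne_zero {s : ℝ} (hs : s ≠ 0) (z : EuclideanSpace ℝ (Fin n)) : consVec s z ≠ 0 :=
  fun h => hs (by simpa using congrArg (· 0) h)

lemma norm_consVec (s : ℝ) (z : EuclideanSpace ℝ (Fin n)) :
    ‖consVec s z‖ = √(s ^ 2 + ‖z‖ ^ 2) := by
  simp [EuclideanSpace.norm_eq, Fin.sum_univ_succ, Real.sq_sqrt, Finset.sum_nonneg, sq_nonneg]

@[fun_prop]
lemma continuous_tailVec : Continuous (tailVec (n := n)) := by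
  unfold tailVec Fin.tail
  fun_prop

lemma continuous_consVec :
    Continuous fun p : ℝ × EuclideanSpace ℝ (Fin n) => consVec p.1 p.2 := by
  refine (PiLp.continuous_toLp 2 _).comp (continuous_pi fun i => ?_)
  cases i using Fin.cases <;> simp only [Fin.cons_zero, Fin.cons_succ] <;> fun_prop

lemma gnomonicScale_eq_inv_norm (z : EuclideanSpace ℝ (Fin n)) :
    gnomonicScale z = ‖consVec 1 z‖⁻¹ := by
  rw [gnomonicScale, norm_consVec, one_pow]

lemma gnomonicScale_zero : gnomonicScale (0 : EuclideanSpace ℝ (Fin n)) = 1 := by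
  simp [gnomonicScale]

lemma gnomonicScale_pos (z : EuclideanSpace ℝ (Fin n)) : 0 < gnomonicScale z := by
  unfold gnomonicScale
  positivity

lemma gnomonicScale_le_one (z : EuclideanSpace ℝ (Fin n)) : gnomonicScale z ≤ 1 :=
  inv_le_one_of_one_le₀ (Real.one_le_sqrt.2 (by simp))

lemma gnomonicScale_sq_mul (z : EuclideanSpace ℝ (Fin n)) :
    gnomonicScale z ^ 2 * (1 + ‖z‖ ^ 2) = 1 := by
  rw [gnomonicScale, inv_pow, Real.sq_sqrt (by positivity)]
  exact inv_mul_cancel₀ (by positivity)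

@[fun_prop]
lemma continuous_gnomonicScale : Continuous (gnomonicScale (n := n)) := by
  unfold gnomonicScale
  exact Continuous.inv₀ (by fun_prop) fun z => by positivity

@[fun_prop]
lemma continuous_gnomonicPoint : Continuous (gnomonicPoint (n := n)) :=
  continuous_gnomonicScale.smul
    (continuous_consVec.comp (f := fun z => ((1 : ℝ), z)) (by fun_prop))

lemma smul_gnomonicPoint_inv_smul {s : ℝ} (hs : s ≠ 0) (z : EuclideanSpace ℝ (Fin n)) :
    s • gnomonicPoint (s⁻¹ • z) =
      consVec (gnomonicScale (s⁻¹ • z) * s) (gnomonicScale (s⁻¹ • z) • z) := by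
  rw [gnomonicPoint, smul_comm, smul_consVec, smul_consVec, mul_one, smul_inv_smul₀ hs]

lemma measurePreserving_consVec :
    MeasurePreserving fun p : ℝ × EuclideanSpace ℝ (Fin n) => consVec p.1 p.2 := by
  have hcons := (volume_preserving_piFinSuccAbove (fun _ : Fin (n + 1) => ℝ) 0).symm
  have hprod := (MeasurePreserving.id (volume : Measure ℝ)).prod
    (PiLp.volume_preserving_ofLp (Fin n))
  convert (PiLp.volume_preserving_toLp (Fin (n + 1))).comp (hcons.comp hprod) using 1
  · ext p i
    cases i using Fin.cases <;> simp [MeasurableEquiv.piFinSuccAbove]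
  · rfl

lemma lintegral_eq_lintegral_smul_consVec {F : EuclideanSpace ℝ (Fin (n + 1)) → ℝ≥0∞}
    (hF : Measurable F) :
    ∫⁻ v, F v = ∫⁻ z, ∫⁻ s : ℝ, ENNReal.ofReal (|s| ^ n) * F (s • consVec (n := n) 1 z) := by
  have hcons : Measurable fun p : ℝ × EuclideanSpace ℝ (Fin n) => consVec p.1 p.2 :=
    continuous_consVec.measurable
  have hslice : ∀ᵐ s : ℝ, ∫⁻ z : EuclideanSpace ℝ (Fin n), F (consVec s z) =
      ∫⁻ z, ENNReal.ofReal (|s| ^ n) * F (s • consVec (n := n) 1 z) := by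
    filter_upwards [Measure.ae_ne volume 0] with s hs
    rw [lintegral_const_mul _ (by fun_prop), lintegral_eq_mul_lintegral_comp_smul _ hs]
    simp only [finrank_euclideanSpace_fin, smul_consVec, mul_one]
  rw [← measurePreserving_consVec.lintegral_comp hF, Measure.volume_eq_prod,
    lintegral_prod _ (by fun_prop), lintegral_congr_ae hslice,
    lintegral_lintegral_swap (by fun_prop)]

lemma lintegral_gnomonicMeasure {F : EuclideanSpace ℝ (Fin n) → ℝ≥0∞} (hF : Measurable F) :
    ∫⁻ z, F z ∂(gnomonicMeasure n) = ∫⁻ z, ENNReal.ofReal (gnomonicScale z ^ (n + 1)) * F z :=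
  lintegral_withDensity_eq_lintegral_mul _ (by fun_prop) hF

lemma integral_gnomonicMeasure (g : EuclideanSpace ℝ (Fin n) → ℝ) :
    ∫ z, g z ∂(gnomonicMeasure n) = ∫ z, gnomonicScale z ^ (n + 1) * g z := by
  rw [gnomonicMeasure, integral_withDensity_eq_integral_toReal_smul (by fun_prop) (by simp)]
  refine integral_congr_ae (.of_forall fun z => ?_)
  have := gnomonicScale_pos z
  simp only [ENNReal.toReal_ofReal (pow_nonneg this.le (n + 1)), smul_eq_mul]

lemma map_coe_toSphere_eq_gnomonicMeasure :
    (volume : Measure (EuclideanSpace ℝ (Fin (n + 1)))).toSphere.map (↑) =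
      (gnomonicMeasure n).map gnomonicPoint +
        (gnomonicMeasure n).map fun z => -gnomonicPoint z := by
  have hP := (continuous_gnomonicPoint (n := n)).measurable
  have hnegP : Measurable fun z : EuclideanSpace ℝ (Fin n) => -gnomonicPoint z := hP.neg
  refine Measure.ext_of_lintegral _ fun G hG => ?_
  have hcone : Measurable ((ball 0 1).indicator
      fun v : EuclideanSpace ℝ (Fin (n + 1)) => G (‖v‖⁻¹ • v)) :=
    (hG.comp measurable_norm_inv_smul).indicator measurableSet_ball
  have hweight : ∀ z : EuclideanSpace ℝ (Fin n), ((n + 1 : ℕ) : ℝ≥0∞) *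
      ENNReal.ofReal (‖consVec 1 z‖⁻¹ ^ (n + 1) / (n + 1)) =
        ENNReal.ofReal (gnomonicScale z ^ (n + 1)) := fun z => by
    rw [← gnomonicScale_eq_inv_norm, ← ENNReal.ofReal_natCast,
      ← ENNReal.ofReal_mul (by positivity)]
    congr 1
    push_cast
    field_simp
  rw [map_coe_toSphere, lintegral_smul_measure, lintegral_map hG measurable_norm_inv_smul,
    ← lintegral_indicator measurableSet_ball, lintegral_eq_lintegral_smul_consVec hcone,
    lintegral_add_measure, lintegral_map hG hP, lintegral_map hG hnegP,
    lintegral_gnomonicMeasure (F := fun z => G (gnomonicPoint z)) (by fun_prop),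
    lintegral_gnomonicMeasure (F := fun z => G (-gnomonicPoint z)) (by fun_prop),
    ← lintegral_add_left (by fun_prop), finrank_euclideanSpace_fin, smul_eq_mul,
    ← lintegral_const_mul' _ _ (by simp)]
  refine lintegral_congr fun z => ?_
  rw [lintegral_pow_mul_indicator_ball n G (consVec_ne_zero one_ne_zero z), ← mul_assoc, hweight,
    ← gnomonicScale_eq_inv_norm]
  exact mul_add _ _ _

end Gnomonic

section SphereSurfaceMeasure

open Metric

variable {n : ℕ}

lemma sphereSurfaceMeasure_eq_map_smul (r : ℝ) : sphereSurfaceMeasure n r =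
    ENNReal.ofReal (r ^ n) • ((volume : Measure (EuclideanSpace ℝ (Fin (n + 1)))).toSphere.map
      (↑)).map fun v => r • v := by
  rw [Measure.map_map (by fun_prop) (by fun_prop)]
  rfl

lemma integrable_sphereSurfaceMeasure (r : ℝ) {g : EuclideanSpace ℝ (Fin (n + 1)) → ℝ}
    (hg : Continuous g) : Integrable g (sphereSurfaceMeasure n r) := by
  rw [sphereSurfaceMeasure_eq_map_smul]
  refine Integrable.smul_measure ?_ ENNReal.ofReal_ne_top
  rw [integrable_map_measure hg.aestronglyMeasurable (by fun_prop)]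
  exact integrable_map_coe_toSphere _ (by fun_prop)

instance isFiniteMeasure_sphereSurfaceMeasure (r : ℝ) :
    IsFiniteMeasure (sphereSurfaceMeasure n r) :=
  (integrable_const_iff_isFiniteMeasure (one_ne_zero (α := ℝ))).1
    (integrable_sphereSurfaceMeasure r continuous_const)

lemma ae_mem_sphere_sphereSurfaceMeasure (r : ℝ) :
    ∀ᵐ t ∂(sphereSurfaceMeasure n r), t ∈ sphere 0 |r| := by
  refine Measure.ae_smul_measure ?_ _
  rw [ae_map_iff (p := (· ∈ sphere 0 |r|)) (by fun_prop) isClosed_sphere.measurableSet]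
  exact .of_forall fun u => by simp [norm_smul]

lemma measurePreserving_sphereSurfaceMeasure (r : ℝ)
    (e : EuclideanSpace ℝ (Fin (n + 1)) ≃ₗᵢ[ℝ] EuclideanSpace ℝ (Fin (n + 1))) :
    MeasurePreserving e (sphereSurfaceMeasure n r) (sphereSurfaceMeasure n r) := by
  have he := e.continuous.measurable
  have hsmul : Measurable fun v : EuclideanSpace ℝ (Fin (n + 1)) => r • v := by fun_prop
  have hcomm : e ∘ (fun v => r • v) = (fun v => r • v) ∘ e := by
    ext v : 1
    exact map_smul e r v
  refine ⟨he, ?_⟩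
  rw [sphereSurfaceMeasure_eq_map_smul, Measure.map_smul, Measure.map_map he hsmul, hcomm,
    ← Measure.map_map hsmul he, (measurePreserving_map_coe_toSphere e.measurePreserving).map_eq]

lemma integral_sphereSurfaceMeasure_eq_zero_of_odd (r : ℝ) {g : EuclideanSpace ℝ (Fin (n + 1)) → ℝ}
    (e : EuclideanSpace ℝ (Fin (n + 1)) ≃ₗᵢ[ℝ] EuclideanSpace ℝ (Fin (n + 1)))
    (hg : ∀ t, g (e t) = -g t) : ∫ t, g t ∂(sphereSurfaceMeasure n r) = 0 := by
  have h := (measurePreserving_sphereSurfaceMeasure r e).integral_comp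
    e.toHomeomorph.measurableEmbedding g
  simp only [hg, integral_neg] at h
  linarith

/-- The integral of `g` over the open hemisphere of radius `|s|` with pole `(s, 0)`. A signed
radius lets one statement cover the limits at both poles. -/
noncomputable def hemisphereIntegral (g : EuclideanSpace ℝ (Fin (n + 1)) → ℝ) (s : ℝ) : ℝ :=
  |s| ^ n * ∫ z, g (s • gnomonicPoint z) ∂(gnomonicMeasure n)

lemma hemisphereIntegral_eq (g : EuclideanSpace ℝ (Fin (n + 1)) → ℝ) {s : ℝ} (hs : s ≠ 0) :
    hemisphereIntegral g s = ∫ z, gnomonicScale (s⁻¹ • z) ^ (n + 1) *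
      g (consVec (gnomonicScale (s⁻¹ • z) * s) (gnomonicScale (s⁻¹ • z) • z)) := by
  simp only [hemisphereIntegral, integral_gnomonicMeasure, ← smul_gnomonicPoint_inv_smul hs]
  rw [Measure.integral_comp_inv_smul volume fun z : EuclideanSpace ℝ (Fin n) =>
      gnomonicScale z ^ (n + 1) * g (s • gnomonicPoint z),
    finrank_euclideanSpace_fin, abs_pow, smul_eq_mul]

lemma integral_sphereSurfaceMeasure_eq_add_hemisphereIntegral {r : ℝ} (hr : 0 < r)
    {g : EuclideanSpace ℝ (Fin (n + 1)) → ℝ} (hg : Continuous g) :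
    ∫ t, g t ∂(sphereSurfaceMeasure n r) =
      hemisphereIntegral g r + hemisphereIntegral g (-r) := by
  have hP := (continuous_gnomonicPoint (n := n)).measurable
  have hnegP : Measurable fun z : EuclideanSpace ℝ (Fin n) => -gnomonicPoint z := hP.neg
  have hgr : Continuous fun v => g (r • v) := by fun_prop
  have hgint : Integrable (fun v => g (r • v)) ((volume : Measure
      (EuclideanSpace ℝ (Fin (n + 1)))).toSphere.map (↑)) :=
    integrable_map_coe_toSphere _ hgr
  rw [map_coe_toSphere_eq_gnomonicMeasure] at hgint
  rw [sphereSurfaceMeasure_eq_map_smul, integral_smul_measure,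
    integral_map (by fun_prop) hg.aestronglyMeasurable, map_coe_toSphere_eq_gnomonicMeasure,
    integral_add_measure hgint.left_of_add_measure hgint.right_of_add_measure,
    integral_map hP.aemeasurable hgr.aestronglyMeasurable,
    integral_map hnegP.aemeasurable hgr.aestronglyMeasurable,
    ENNReal.toReal_ofReal (by positivity), smul_eq_mul, mul_add]
  simp [hemisphereIntegral, abs_of_pos hr]

end SphereSurfaceMeasure

section GaussianMoments

open ProbabilityTheory Real

lemma exp_quadratic_eq_mul_gaussianPDFReal {lam : ℝ} (hlam : lam < 0) (tau x : ℝ) :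
    exp (lam * x ^ 2 + tau * x) = √(π / -lam) * exp (-(tau ^ 2 / (4 * lam))) *
      gaussianPDFReal (tau / (2 * -lam)) (toNNReal (1 / (2 * -lam))) x := by
  obtain ⟨a, rfl⟩ : ∃ a, lam = -a := ⟨-lam, (neg_neg lam).symm⟩
  have ha : 0 < a := neg_lt_zero.1 hlam
  have hsqrt : √(π / a) ≠ 0 := (sqrt_pos.2 (by positivity)).ne'
  have hvar : 2 * π * (1 / (2 * a)) = π / a := by field_simp
  rw [neg_neg, gaussianPDFReal, coe_toNNReal _ (by positivity : 0 ≤ 1 / (2 * a)), hvar,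
    mul_mul_mul_comm, mul_inv_cancel₀ hsqrt, one_mul, ← exp_add]
  congr 1
  field_simp
  ring

lemma integral_mul_exp_quadratic {lam : ℝ} (hlam : lam < 0) (tau : ℝ) (h : ℝ → ℝ) :
    ∫ x, h x * exp (lam * x ^ 2 + tau * x) = √(π / -lam) * exp (-(tau ^ 2 / (4 * lam))) *
      ∫ x, h x ∂gaussianReal (tau / (2 * -lam)) (toNNReal (1 / (2 * -lam))) := by
  have hvar : toNNReal (1 / (2 * -lam)) ≠ 0 :=
    (toNNReal_pos.2 (one_div_pos.2 (by linarith))).ne'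
  rw [integral_gaussianReal_eq_integral_smul hvar, ← integral_const_mul]
  refine integral_congr_ae (.of_forall fun x => ?_)
  simp only [exp_quadratic_eq_mul_gaussianPDFReal hlam, smul_eq_mul]
  ring

lemma integral_exp_quadratic {lam : ℝ} (hlam : lam < 0) (tau : ℝ) :
    ∫ x, exp (lam * x ^ 2 + tau * x) = √(π / -lam) * exp (-(tau ^ 2 / (4 * lam))) := by
  simpa using integral_mul_exp_quadratic hlam tau 1

lemma integral_id_mul_exp_quadratic {lam : ℝ} (hlam : lam < 0) (tau : ℝ) :
    ∫ x, x * exp (lam * x ^ 2 + tau * x) =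
      tau / (2 * -lam) * ∫ x, exp (lam * x ^ 2 + tau * x) := by
  rw [integral_exp_quadratic hlam, integral_mul_exp_quadratic hlam tau fun x => x,
    integral_id_gaussianReal, mul_comm]

lemma integral_sq_mul_exp_quadratic {lam : ℝ} (hlam : lam < 0) (tau : ℝ) :
    ∫ x, x ^ 2 * exp (lam * x ^ 2 + tau * x) =
      ((tau / (2 * lam)) ^ 2 + 1 / (2 * -lam)) * ∫ x, exp (lam * x ^ 2 + tau * x) := by
  have hvar := variance_id_gaussianReal (μ := tau / (2 * -lam)) (v := toNNReal (1 / (2 * -lam)))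
  rw [variance_eq_sub (memLp_id_gaussianReal 2),
    coe_toNNReal _ (one_div_nonneg.2 (by linarith)), mul_neg, div_neg] at hvar
  simp only [id, Pi.pow_apply, integral_id_gaussianReal, neg_sq] at hvar
  rw [integral_exp_quadratic hlam, integral_mul_exp_quadratic hlam tau fun x => x ^ 2,
    mul_comm, mul_neg, div_neg, sub_eq_iff_eq_add'.1 hvar]

variable {ι : Type*} [Fintype ι]

/-- The Fisher–Bingham density, unnormalised. It serves both on the sphere and, with negative
`lam`, as the Gaussian weight on the tangent space at a pole. -/
noncomputable def fisherBinghamDensity (lam tau : ι → ℝ) (t : EuclideanSpace ℝ ι) : ℝ :=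
  exp (∑ i, lam i * t i ^ 2 + ∑ i, tau i * t i)

lemma fisherBinghamDensity_pos (lam tau : ι → ℝ) (t : EuclideanSpace ℝ ι) :
    0 < fisherBinghamDensity lam tau t :=
  exp_pos _

lemma fisherBinghamDensity_eq_prod (lam tau : ι → ℝ) (t : EuclideanSpace ℝ ι) :
    fisherBinghamDensity lam tau t = ∏ i, exp (lam i * t i ^ 2 + tau i * t i) := by
  rw [fisherBinghamDensity, ← exp_sum, Finset.sum_add_distrib]

@[fun_prop]
lemma continuous_fisherBinghamDensity (lam tau : ι → ℝ) :
    Continuous (fisherBinghamDensity lam tau) := by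
  unfold fisherBinghamDensity
  fun_prop

lemma integral_euclideanSpace_prod (F : ι → ℝ → ℝ) :
    ∫ y : EuclideanSpace ℝ ι, ∏ i, F i (y i) = ∏ i, ∫ x, F i x := by
  rw [← integral_fintype_prod_volume_eq_prod]
  exact (PiLp.volume_preserving_ofLp ι).integral_comp
    (MeasurableEquiv.toLp 2 _).symm.measurableEmbedding fun z : ι → ℝ => ∏ i, F i (z i)

lemma integral_fisherBinghamDensity {lam : ι → ℝ} (hlam : ∀ i, lam i < 0) (tau : ι → ℝ) :
    ∫ y, fisherBinghamDensity lam tau y =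
      π ^ ((Fintype.card ι : ℝ) / 2) / (∏ i, (-lam i) ^ (1 / 2 : ℝ)) *
        exp (-∑ i, tau i ^ 2 / (4 * lam i)) := by
  simp only [fisherBinghamDensity_eq_prod]
  rw [integral_euclideanSpace_prod fun i x => exp (lam i * x ^ 2 + tau i * x)]
  simp only [integral_exp_quadratic (hlam _), sqrt_div pi_pos.le, Finset.prod_mul_distrib,
    Finset.prod_div_distrib, ← Finset.sum_neg_distrib, exp_sum, sqrt_eq_rpow, Finset.prod_const,
    Finset.card_univ]
  rw [← rpow_mul_natCast pi_pos.le, one_div_mul_eq_div]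

lemma integral_coord_mul_fisherBinghamDensity (lam tau : ι → ℝ) (j : ι) {h : ℝ → ℝ} {K : ℝ}
    (hK : ∫ x, h x * exp (lam j * x ^ 2 + tau j * x) =
      K * ∫ x, exp (lam j * x ^ 2 + tau j * x)) :
    ∫ y, h (y j) * fisherBinghamDensity lam tau y = K * ∫ y, fisherBinghamDensity lam tau y := by
  classical
  have hfactor : ∀ y : EuclideanSpace ℝ ι, h (y j) * fisherBinghamDensity lam tau y =
      ∏ i, (if i = j then h (y i) else 1) * exp (lam i * y i ^ 2 + tau i * y i) := fun y => by
    rw [fisherBinghamDensity_eq_prod, Finset.prod_mul_distrib]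
    simp
  have hmoment : ∀ i, ∫ x, (if i = j then h x else 1) * exp (lam i * x ^ 2 + tau i * x) =
      (if i = j then K else 1) * ∫ x, exp (lam i * x ^ 2 + tau i * x) := fun i => by
    obtain rfl | hij := eq_or_ne i j <;> simp [*]
  simp only [hfactor]
  simp only [fisherBinghamDensity_eq_prod]
  rw [integral_euclideanSpace_prod fun i x =>
      (if i = j then h x else 1) * exp (lam i * x ^ 2 + tau i * x),
    integral_euclideanSpace_prod fun i x => exp (lam i * x ^ 2 + tau i * x)]
  simp only [hmoment, Finset.prod_mul_distrib]
  simp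

end GaussianMoments

section Laplace

open Filter Topology Bornology Real

lemma exists_one_add_sq_pow_mul_exp_le {α : ℝ} (hα : 0 < α) (β : ℝ) (N : ℕ) :
    ∃ K, ∀ x : ℝ, (1 + x ^ 2) ^ N * exp (β * x - α * x ^ 2) ≤ K := by
  set b := α / 2 with hb
  have hb0 : 0 < b := half_pos hα
  refine ⟨N.factorial / b ^ N * exp (b + β ^ 2 / (4 * b)), fun x => ?_⟩
  have hpow : (1 + x ^ 2) ^ N ≤ N.factorial / b ^ N * exp (b * (1 + x ^ 2)) := by
    have h := pow_div_factorial_le_exp (b * (1 + x ^ 2)) (by positivity) N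
    rw [div_le_iff₀ (by positivity), mul_pow] at h
    rw [div_mul_eq_mul_div, le_div_iff₀ (by positivity)]
    linarith
  have hsq : β ^ 2 / (4 * b) - (β * x - b * x ^ 2) = (2 * b * x - β) ^ 2 / (4 * b) := by
    field_simp
    ring
  have hexp : b * (1 + x ^ 2) + (β * x - α * x ^ 2) ≤ b + β ^ 2 / (4 * b) := by
    have : 0 ≤ (2 * b * x - β) ^ 2 / (4 * b) := by positivity
    have : α = 2 * b := by rw [hb]; ring
    nlinarith
  calc (1 + x ^ 2) ^ N * exp (β * x - α * x ^ 2)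
      ≤ N.factorial / b ^ N * exp (b * (1 + x ^ 2)) * exp (β * x - α * x ^ 2) := by gcongr
    _ = N.factorial / b ^ N * exp (b * (1 + x ^ 2) + (β * x - α * x ^ 2)) := by
      rw [mul_assoc, ← exp_add]
    _ ≤ N.factorial / b ^ N * exp (b + β ^ 2 / (4 * b)) := by gcongr

lemma exists_fisherBinghamDensity_le {ι : Type*} [Fintype ι] {lam : ι → ℝ}
    (hlam : ∀ i, lam i < 0) (tau : ι → ℝ) :
    ∃ α > 0, ∃ β, ∀ y, fisherBinghamDensity lam tau y ≤ exp (β * ‖y‖ - α * ‖y‖ ^ 2) := by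
  obtain ⟨α, hα, hαlam⟩ : ∃ α > 0, ∀ i, lam i ≤ -α := by
    cases isEmpty_or_nonempty ι with
    | inl h => exact ⟨1, one_pos, fun i => h.elim i⟩
    | inr h =>
      obtain ⟨i, hi⟩ := Finite.exists_max lam
      exact ⟨-lam i, neg_pos.2 (hlam i), fun j => (hi j).trans_eq (neg_neg _).symm⟩
  refine ⟨α, hα, ‖WithLp.toLp 2 tau‖, fun y => exp_le_exp.2 ?_⟩
  have hquad : ∑ i, lam i * y i ^ 2 ≤ -α * ‖y‖ ^ 2 := by
    rw [EuclideanSpace.real_norm_sq_eq, Finset.mul_sum]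
    exact Finset.sum_le_sum fun i _ => mul_le_mul_of_nonneg_right (hαlam i) (sq_nonneg _)
  have hlin : ∑ i, tau i * y i ≤ ‖y‖ * ‖WithLp.toLp 2 tau‖ := by
    simpa [PiLp.inner_apply] using real_inner_le_norm y (WithLp.toLp 2 tau)
  linarith

lemma exists_pow_mul_exp_mul_fisherBinghamDensity_le {ι : Type*} [Fintype ι] {lam : ι → ℝ}
    (hlam : ∀ i, lam i < 0) (tau : ι → ℝ) (c : ℝ) (N : ℕ) :
    ∃ K, ∀ y, (1 + ‖y‖ ^ 2) ^ N * exp (c * ‖y‖) * fisherBinghamDensity lam tau y ≤ K := by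
  obtain ⟨α, hα, β, hle⟩ := exists_fisherBinghamDensity_le hlam tau
  obtain ⟨K, hK⟩ := exists_one_add_sq_pow_mul_exp_le hα (c + β) N
  refine ⟨K, fun y => le_trans ?_ (hK ‖y‖)⟩
  calc (1 + ‖y‖ ^ 2) ^ N * exp (c * ‖y‖) * fisherBinghamDensity lam tau y
      ≤ (1 + ‖y‖ ^ 2) ^ N * exp (c * ‖y‖) * exp (β * ‖y‖ - α * ‖y‖ ^ 2) := by
        gcongr
        exact hle y
    _ = (1 + ‖y‖ ^ 2) ^ N * exp ((c + β) * ‖y‖ - α * ‖y‖ ^ 2) := by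
        rw [mul_assoc, ← exp_add]
        ring_nf

variable {n : ℕ}

lemma integrable_gnomonicScale_pow :
    Integrable fun z : EuclideanSpace ℝ (Fin n) => gnomonicScale z ^ (n + 1) := by
  refine (integrable_rpow_neg_one_add_norm_sq (E := EuclideanSpace ℝ (Fin n)) (μ := volume)
    (r := (n : ℝ) + 1) (by simp)).congr (.of_forall fun z => ?_)
  have h0 : 0 ≤ 1 + ‖z‖ ^ 2 := by positivity
  simp only [gnomonicScale]
  rw [sqrt_eq_rpow, ← rpow_neg h0, ← rpow_mul_natCast h0]
  congr 1
  push_cast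
  ring

lemma le_one_add_norm_smul_sq_mul_gnomonicScale {k : ℝ} (hk0 : 0 ≤ k) (hk1 : k ≤ 1)
    (z : EuclideanSpace ℝ (Fin n)) : k ≤ (1 + ‖k • z‖ ^ 2) * gnomonicScale z := by
  rw [gnomonicScale, ← div_eq_mul_inv, le_div_iff₀ (by positivity)]
  calc k * √(1 + ‖z‖ ^ 2) = √(k ^ 2 * (1 + ‖z‖ ^ 2)) := by
        rw [sqrt_mul (sq_nonneg k), sqrt_sq hk0]
    _ ≤ √(1 + ‖k • z‖ ^ 2) := by
        rw [norm_smul, norm_of_nonneg hk0, mul_pow, mul_add, mul_one]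
        gcongr
        exact pow_le_one₀ hk0 hk1
    _ ≤ 1 + ‖k • z‖ ^ 2 := sqrt_le_self_iff.2 (.inr (by simp))

lemma one_sub_gnomonicScale_le_mul_norm (w : EuclideanSpace ℝ (Fin n)) :
    1 - gnomonicScale w ≤ gnomonicScale w * ‖w‖ := by
  have hpos := gnomonicScale_pos w
  refine abs_le_of_sq_le_sq' ?_ (by positivity) |>.2
  nlinarith [gnomonicScale_sq_mul w, gnomonicScale_le_one w]

lemma one_sub_gnomonicScale_le_norm_sq (w : EuclideanSpace ℝ (Fin n)) :
    1 - gnomonicScale w ≤ ‖w‖ ^ 2 := by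
  nlinarith [gnomonicScale_sq_mul w, gnomonicScale_pos w, gnomonicScale_le_one w,
    mul_nonneg (sub_nonneg.2 (gnomonicScale_le_one w)) (sq_nonneg ‖w‖), sq_nonneg ‖w‖]

lemma abs_gnomonicScale_mul_sub (w : EuclideanSpace ℝ (Fin n)) (s : ℝ) :
    |gnomonicScale w * s - s| = |s| * (1 - gnomonicScale w) := by
  rw [← neg_sub, abs_neg, ← one_sub_mul, abs_mul, mul_comm,
    abs_of_nonneg (sub_nonneg.2 (gnomonicScale_le_one w))]

lemma abs_gnomonicScale_inv_smul_mul_sub_le {s : ℝ} (hs : s ≠ 0) (z : EuclideanSpace ℝ (Fin n)) :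
    |gnomonicScale (s⁻¹ • z) * s - s| ≤ ‖gnomonicScale (s⁻¹ • z) • z‖ := by
  have h := one_sub_gnomonicScale_le_mul_norm (s⁻¹ • z)
  rw [norm_smul s⁻¹, norm_inv, norm_eq_abs] at h
  rw [abs_gnomonicScale_mul_sub, norm_smul, norm_of_nonneg (gnomonicScale_pos _).le]
  calc |s| * (1 - gnomonicScale (s⁻¹ • z))
      ≤ |s| * (gnomonicScale (s⁻¹ • z) * (|s|⁻¹ * ‖z‖)) := by gcongr
    _ = gnomonicScale (s⁻¹ • z) * ‖z‖ := by field_simp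

lemma tendsto_gnomonicScale_inv_smul (z : EuclideanSpace ℝ (Fin n)) :
    Tendsto (fun s : ℝ => gnomonicScale (s⁻¹ • z)) (cobounded ℝ) (𝓝 1) := by
  have hlim := tendsto_inv₀_cobounded (α := ℝ).smul_const z
  rw [zero_smul] at hlim
  have h := (continuous_gnomonicScale.tendsto 0).comp hlim
  rwa [gnomonicScale_zero] at h

lemma tendsto_gnomonicScale_inv_smul_mul_sub (z : EuclideanSpace ℝ (Fin n)) :
    Tendsto (fun s : ℝ => gnomonicScale (s⁻¹ • z) * s - s) (cobounded ℝ) (𝓝 0) := by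
  have hlim := (tendsto_inv₀_cobounded (α := ℝ)).norm.mul_const (‖z‖ ^ 2)
  rw [norm_zero, zero_mul] at hlim
  refine squeeze_zero_norm' ?_ hlim
  filter_upwards [eventually_ne_cobounded 0] with s hs
  have h := one_sub_gnomonicScale_le_norm_sq (s⁻¹ • z)
  rw [norm_smul, mul_pow] at h
  rw [norm_eq_abs, abs_gnomonicScale_mul_sub]
  calc |s| * (1 - gnomonicScale (s⁻¹ • z)) ≤ |s| * (‖s⁻¹‖ ^ 2 * ‖z‖ ^ 2) := by gcongr
    _ = ‖s⁻¹‖ * ‖z‖ ^ 2 := by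
      rw [norm_inv, norm_eq_abs]
      field_simp

lemma gnomonicScale_pow_mul_le {u : EuclideanSpace ℝ (Fin n) → ℝ} {c K : ℝ}
    (hK : ∀ y, (1 + ‖y‖ ^ 2) ^ (n + 1) * exp (|c| * ‖y‖) * |u y| ≤ K) (m : ℕ)
    {s : ℝ} (hs : s ≠ 0) (z : EuclideanSpace ℝ (Fin n)) :
    ‖gnomonicScale (s⁻¹ • z) ^ (n + 1 + m) * (u (gnomonicScale (s⁻¹ • z) • z) *
      exp (c * (gnomonicScale (s⁻¹ • z) * s - s)))‖ ≤ K * gnomonicScale z ^ (n + 1) := by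
  have hδ := abs_gnomonicScale_inv_smul_mul_sub_le hs z
  have hk0 := gnomonicScale_pos (s⁻¹ • z)
  have hk1 := gnomonicScale_le_one (s⁻¹ • z)
  set k := gnomonicScale (s⁻¹ • z)
  have hpow : k ^ (n + 1 + m) ≤ (1 + ‖k • z‖ ^ 2) ^ (n + 1) * gnomonicScale z ^ (n + 1) := by
    rw [← mul_pow]
    exact (pow_le_pow_of_le_one hk0.le hk1 (Nat.le_add_right _ _)).trans
      (pow_le_pow_left₀ hk0.le (le_one_add_norm_smul_sq_mul_gnomonicScale hk0.le hk1 z) _)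
  have hexp : exp (c * (k * s - s)) ≤ exp (|c| * ‖k • z‖) := by
    refine exp_le_exp.2 ((le_abs_self _).trans ?_)
    rw [abs_mul]
    gcongr
  have hz := gnomonicScale_pos z
  rw [norm_mul, norm_mul, norm_of_nonneg (exp_pos _).le, norm_of_nonneg (by positivity),
    norm_eq_abs]
  calc k ^ (n + 1 + m) * (|u (k • z)| * exp (c * (k * s - s)))
      ≤ (1 + ‖k • z‖ ^ 2) ^ (n + 1) * gnomonicScale z ^ (n + 1) *
          (|u (k • z)| * exp (|c| * ‖k • z‖)) := by gcongr
    _ = (1 + ‖k • z‖ ^ 2) ^ (n + 1) * exp (|c| * ‖k • z‖) * |u (k • z)| *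
          gnomonicScale z ^ (n + 1) := by ring
    _ ≤ K * gnomonicScale z ^ (n + 1) := by
      gcongr
      exact hK _

lemma tendsto_integral_gnomonicScale_pow_mul {u : EuclideanSpace ℝ (Fin n) → ℝ} (hu : Continuous u)
    {c K : ℝ} (hK : ∀ y, (1 + ‖y‖ ^ 2) ^ (n + 1) * exp (|c| * ‖y‖) * |u y| ≤ K) (m : ℕ) :
    Tendsto (fun s : ℝ => ∫ z, gnomonicScale (s⁻¹ • z) ^ (n + 1 + m) *
      (u (gnomonicScale (s⁻¹ • z) • z) * exp (c * (gnomonicScale (s⁻¹ • z) * s - s))))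
      (cobounded ℝ) (𝓝 (∫ y, u y)) := by
  have : IsCountablyGenerated (cobounded ℝ) := by
    rw [IsOrderBornology.cobounded_eq]
    infer_instance
  refine tendsto_integral_filter_of_dominated_convergence
    (fun z => K * gnomonicScale z ^ (n + 1)) ?_ ?_ (integrable_gnomonicScale_pow.const_mul K) ?_
  · exact .of_forall fun s => Continuous.aestronglyMeasurable (by fun_prop)
  · filter_upwards [eventually_ne_cobounded 0] with s hs
    exact .of_forall fun z => gnomonicScale_pow_mul_le hK m hs z
  · refine .of_forall fun z => ?_
    have hk := tendsto_gnomonicScale_inv_smul z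
    have hδ := (tendsto_gnomonicScale_inv_smul_mul_sub z).const_mul c
    have hu' := (hu.tendsto _).comp (hk.smul_const z)
    simpa using (hk.pow (n + 1 + m)).mul (hu'.mul hδ.rexp)

end Laplace

section Asymptotics

open Filter Topology Bornology Asymptotics Real

lemma isEquivalent_mul_add_mul_of_tendsto {α : Type*} {l : Filter α} {A B G H : α → ℝ} {L : ℝ}
    (hL : L ≠ 0) (hA : A =O[l] (A + B)) (hG : Tendsto G l (𝓝 L)) (hH : Tendsto H l (𝓝 L)) :
    (fun x => A x * G x + B x * H x) ~[l] fun x => (A x + B x) * L := by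
  have hB : B =O[l] (A + B) := by
    simpa using (isBigO_refl (A + B) l).sub hA
  have hG' : (fun x => G x - L) =o[l] fun _ => L :=
    (isLittleO_const_iff hL).2 (tendsto_sub_nhds_zero_iff.2 hG)
  have hH' : (fun x => H x - L) =o[l] fun _ => L :=
    (isLittleO_const_iff hL).2 (tendsto_sub_nhds_zero_iff.2 hH)
  refine ((hA.mul_isLittleO hG').add (hB.mul_isLittleO hH')).congr_left fun x => ?_
  simp only [Pi.sub_apply]
  ring

lemma exp_isBigO_exp_add_neg_one_pow_mul_exp_neg {c : ℝ} {m : ℕ} (h : Even m ∨ c ≠ 0) :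
    (fun r => exp (r * c)) =O[atTop] fun r => exp (r * c) + (-1) ^ m * exp (-(r * c)) := by
  obtain hm | hm := m.even_or_odd
  · refine isBigO_of_le _ fun r => ?_
    rw [hm.neg_one_pow, one_mul, norm_of_nonneg (by positivity), norm_of_nonneg (by positivity)]
    exact le_add_of_nonneg_right (exp_pos _).le
  · have hc : 0 < |c| := abs_pos.2 (h.resolve_left (Nat.not_even_iff_odd.2 hm))
    refine IsBigO.of_bound 2 ?_
    filter_upwards [eventually_ge_atTop 0, eventually_ge_atTop |c|⁻¹] with r hr hrc
    have habs : 1 ≤ |r * c| := by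
      rwa [abs_mul, abs_of_nonneg hr, ← inv_le_iff_one_le_mul₀ hc]
    have hexp : 2 ≤ exp |r * c| := by linarith [add_one_le_exp |r * c|]
    have hneg : exp (-|r * c|) ≤ 1 := exp_le_one_iff.2 (neg_nonpos.2 (abs_nonneg _))
    have hsinh : exp (r * c) + (-1) ^ m * exp (-(r * c)) = 2 * sinh (r * c) := by
      rw [hm.neg_one_pow, sinh_eq]
      ring
    rw [hsinh, norm_mul, norm_eq_abs (sinh _), abs_sinh, sinh_eq, norm_of_nonneg (exp_pos _).le,
      norm_of_nonneg zero_le_two]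
    linarith [exp_le_exp.2 (le_abs_self (r * c))]

variable {n : ℕ}

/-- The Gaussian weight induced by the Fisher–Bingham density on the tangent space at the poles
`(±r, 0)`. -/
noncomputable def tangentDensity (lam tau : Fin (n + 1) → ℝ) : EuclideanSpace ℝ (Fin n) → ℝ :=
  fisherBinghamDensity (fun i => lam i.succ - lam 0) (fun i => tau i.succ)

@[fun_prop]
lemma continuous_tangentDensity (lam tau : Fin (n + 1) → ℝ) : Continuous (tangentDensity lam tau) :=
  continuous_fisherBinghamDensity _ _

lemma fisherBinghamDensity_consVec (lam tau : Fin (n + 1) → ℝ) (x : ℝ)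
    (y : EuclideanSpace ℝ (Fin n)) :
    fisherBinghamDensity lam tau (consVec x y) =
      exp ((x ^ 2 + ‖y‖ ^ 2) * lam 0 + x * tau 0) * tangentDensity lam tau y := by
  simp only [tangentDensity, fisherBinghamDensity, ← exp_add, Fin.sum_univ_succ, consVec_zero,
    consVec_succ, EuclideanSpace.real_norm_sq_eq, sub_mul, Finset.sum_sub_distrib,
    ← Finset.mul_sum]
  ring_nf

lemma gnomonicScale_mul_sq_add_norm_smul_sq {s : ℝ} (hs : s ≠ 0) (z : EuclideanSpace ℝ (Fin n)) :
    (gnomonicScale (s⁻¹ • z) * s) ^ 2 + ‖gnomonicScale (s⁻¹ • z) • z‖ ^ 2 = s ^ 2 := by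
  have h := gnomonicScale_sq_mul (s⁻¹ • z)
  rw [norm_smul, mul_pow, norm_eq_abs, sq_abs] at h
  rw [norm_smul, mul_pow, mul_pow, norm_eq_abs, sq_abs]
  generalize gnomonicScale (s⁻¹ • z) = k at h ⊢
  field_simp at h
  linarith

lemma hemisphereIntegral_mul_fisherBinghamDensity (lam tau : Fin (n + 1) → ℝ) (m : ℕ)
    (v : EuclideanSpace ℝ (Fin n) → ℝ) {s : ℝ} (hs : s ≠ 0) :
    hemisphereIntegral (fun t => t 0 ^ m * v (tailVec t) * fisherBinghamDensity lam tau t) s =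
      s ^ m * exp (s ^ 2 * lam 0 + s * tau 0) *
        ∫ z, gnomonicScale (s⁻¹ • z) ^ (n + 1 + m) *
          (v (gnomonicScale (s⁻¹ • z) • z) * tangentDensity lam tau (gnomonicScale (s⁻¹ • z) • z) *
            exp (tau 0 * (gnomonicScale (s⁻¹ • z) * s - s))) := by
  rw [hemisphereIntegral_eq _ hs, ← integral_const_mul]
  refine integral_congr_ae (.of_forall fun z => ?_)
  simp only [fisherBinghamDensity_consVec, gnomonicScale_mul_sq_add_norm_smul_sq hs, consVec_zero,
    tailVec_consVec]
  generalize gnomonicScale (s⁻¹ • z) = k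
  have hexp : exp (s ^ 2 * lam 0 + k * s * tau 0) =
      exp (s ^ 2 * lam 0 + s * tau 0) * exp (tau 0 * (k * s - s)) := by
    rw [← exp_add]
    ring_nf
  rw [hexp]
  ring

lemma exists_pow_mul_exp_mul_tangentDensity_le {lam : Fin (n + 1) → ℝ}
    (h_top : ∀ j : Fin n, lam j.succ < lam 0) (tau : Fin (n + 1) → ℝ)
    {v : EuclideanSpace ℝ (Fin n) → ℝ} {N : ℕ} (hv : ∀ y, |v y| ≤ (1 + ‖y‖ ^ 2) ^ N) (c : ℝ) :
    ∃ K, ∀ y, (1 + ‖y‖ ^ 2) ^ (n + 1) * exp (c * ‖y‖) * |v y * tangentDensity lam tau y| ≤ K := by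
  obtain ⟨K, hK⟩ := exists_pow_mul_exp_mul_fisherBinghamDensity_le
    (fun i => sub_neg.2 (h_top i)) (fun i => tau i.succ) c (n + 1 + N)
  refine ⟨K, fun y => le_trans ?_ (hK y)⟩
  have hpos := fisherBinghamDensity_pos (fun i : Fin n => lam i.succ - lam 0)
    (fun i => tau i.succ) y
  rw [tangentDensity, abs_mul, abs_of_pos hpos, pow_add _ (n + 1) N]
  calc (1 + ‖y‖ ^ 2) ^ (n + 1) * exp (c * ‖y‖) * (|v y| * fisherBinghamDensity _ _ y)
      ≤ (1 + ‖y‖ ^ 2) ^ (n + 1) * exp (c * ‖y‖) *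
        ((1 + ‖y‖ ^ 2) ^ N * fisherBinghamDensity _ _ y) := by
        gcongr
        exact hv y
    _ = _ := by ring

theorem integral_mul_fisherBinghamDensity_isEquivalent {lam tau : Fin (n + 1) → ℝ}
    (h_top : ∀ j : Fin n, lam j.succ < lam 0) {m : ℕ} (hm : Even m ∨ tau 0 ≠ 0)
    {v : EuclideanSpace ℝ (Fin n) → ℝ} (hv : Continuous v) {N : ℕ}
    (hvN : ∀ y, |v y| ≤ (1 + ‖y‖ ^ 2) ^ N) (hL : ∫ y, v y * tangentDensity lam tau y ≠ 0) :
    (fun r => ∫ t, t 0 ^ m * v (tailVec t) * fisherBinghamDensity lam tau t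
      ∂(sphereSurfaceMeasure n r)) ~[atTop]
    fun r => r ^ m * exp (r ^ 2 * lam 0) *
      ((exp (r * tau 0) + (-1) ^ m * exp (-(r * tau 0))) *
        ∫ y, v y * tangentDensity lam tau y) := by
  obtain ⟨K, hK⟩ := exists_pow_mul_exp_mul_tangentDensity_le h_top tau hvN |tau 0|
  have hlim := tendsto_integral_gnomonicScale_pow_mul (by fun_prop) hK m
  rw [IsOrderBornology.cobounded_eq, tendsto_sup] at hlim
  refine ((IsEquivalent.refl (u := fun r => r ^ m * exp (r ^ 2 * lam 0))).mul
    (isEquivalent_mul_add_mul_of_tendsto hL (exp_isBigO_exp_add_neg_one_pow_mul_exp_neg hm)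
      hlim.2 (hlim.1.comp tendsto_neg_atTop_atBot))).congr_left ?_
  filter_upwards [eventually_gt_atTop 0] with r hr
  rw [integral_sphereSurfaceMeasure_eq_add_hemisphereIntegral hr (by fun_prop),
    hemisphereIntegral_mul_fisherBinghamDensity lam tau m v hr.ne',
    hemisphereIntegral_mul_fisherBinghamDensity lam tau m v (neg_ne_zero.2 hr.ne')]
  simp only [Pi.mul_apply, Function.comp_apply, exp_add, neg_sq, neg_mul, neg_pow r m]
  ring

end Asymptotics

section Derivatives

open Real

variable {n : ℕ}

lemma hasDerivAt_integral_exp_sphereSurfaceMeasure (r : ℝ)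
    {c d : EuclideanSpace ℝ (Fin (n + 1)) → ℝ} (hc : Continuous c) (hd : Continuous d) (x₀ : ℝ) :
    HasDerivAt (fun x => ∫ t, exp (x * c t + d t) ∂(sphereSurfaceMeasure n r))
      (∫ t, c t * exp (x₀ * c t + d t) ∂(sphereSurfaceMeasure n r)) x₀ := by
  have hcompact : IsCompact (Metric.closedBall x₀ 1 ×ˢ
      Metric.sphere (0 : EuclideanSpace ℝ (Fin (n + 1))) |r|) :=
    (isCompact_closedBall _ _).prod (isCompact_sphere _ _)
  obtain ⟨K, hK⟩ := hcompact.exists_bound_of_continuousOn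
    (f := fun p : ℝ × EuclideanSpace ℝ (Fin (n + 1)) => c p.2 * exp (p.1 * c p.2 + d p.2))
    (Continuous.continuousOn (by fun_prop))
  refine (hasDerivAt_integral_of_dominated_loc_of_deriv_le (bound := fun _ => K)
    (F' := fun x t => c t * exp (x * c t + d t))
    (Metric.closedBall_mem_nhds x₀ one_pos) ?_ ?_ ?_ ?_ (integrable_const K) ?_).2
  · exact .of_forall fun x => Continuous.aestronglyMeasurable (by fun_prop)
  · exact integrable_sphereSurfaceMeasure r (by fun_prop)
  · exact Continuous.aestronglyMeasurable (by fun_prop)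
  · filter_upwards [ae_mem_sphere_sphereSurfaceMeasure r] with t ht x hx
    exact hK (x, t) ⟨hx, ht⟩
  · refine .of_forall fun t x _ => ?_
    simpa [mul_comm] using (((hasDerivAt_id x).mul_const (c t)).add_const (d t)).exp

lemma sum_update_mul {ι R : Type*} [Fintype ι] [DecidableEq ι] [CommRing R] (f g : ι → R) (j : ι)
    (x : R) : ∑ i, Function.update f j x i * g i = x * g j + (∑ i, f i * g i - f j * g j) := by
  have h := Finset.sum_update_of_mem (Finset.mem_univ j) (fun i => f i * g i) (x * g j)
  rw [← Finset.sum_erase_eq_sub (Finset.mem_univ j), Finset.erase_eq, ← h]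
  refine Finset.sum_congr rfl fun i _ => ?_
  obtain rfl | hi := eq_or_ne i j <;> simp [*]

lemma hasDerivAt_fisherBingham_lam (lam tau : Fin (n + 1) → ℝ) (r : ℝ) (j : Fin (n + 1)) :
    HasDerivAt (fun x => fisherBingham (Function.update lam j x) tau r)
      (∫ t, t j ^ 2 * fisherBinghamDensity lam tau t ∂(sphereSurfaceMeasure n r)) (lam j) := by
  convert hasDerivAt_integral_exp_sphereSurfaceMeasure r (c := fun t => t j ^ 2)
    (d := fun t => ∑ i, lam i * t i ^ 2 - lam j * t j ^ 2 + ∑ i, tau i * t i) (by fun_prop)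
    (by fun_prop) (lam j) using 5 with x t t
  · simp only [fisherBingham, sum_update_mul, add_assoc]
  · rw [fisherBinghamDensity]
    ring_nf

lemma hasDerivAt_fisherBingham_tau (lam tau : Fin (n + 1) → ℝ) (r : ℝ) (j : Fin (n + 1)) :
    HasDerivAt (fun x => fisherBingham lam (Function.update tau j x) r)
      (∫ t, t j * fisherBinghamDensity lam tau t ∂(sphereSurfaceMeasure n r)) (tau j) := by
  convert hasDerivAt_integral_exp_sphereSurfaceMeasure r (c := fun t => t j)
    (d := fun t => ∑ i, tau i * t i - tau j * t j + ∑ i, lam i * t i ^ 2) (by fun_prop)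
    (by fun_prop) (tau j) using 5 with x t t
  · simp only [fisherBingham, sum_update_mul, add_assoc, add_comm]
  · rw [fisherBinghamDensity]
    ring_nf

lemma fisherBinghamDerivLam_eq_integral (j : Fin (n + 1)) (lam tau : Fin (n + 1) → ℝ) (r : ℝ) :
    fisherBinghamDerivLam j lam tau r =
      ∫ t, t j ^ 2 * fisherBinghamDensity lam tau t ∂(sphereSurfaceMeasure n r) :=
  (hasDerivAt_fisherBingham_lam lam tau r j).deriv

lemma fisherBinghamDerivTau_eq_integral (j : Fin (n + 1)) (lam tau : Fin (n + 1) → ℝ) (r : ℝ) :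
    fisherBinghamDerivTau j lam tau r =
      ∫ t, t j * fisherBinghamDensity lam tau t ∂(sphereSurfaceMeasure n r) :=
  (hasDerivAt_fisherBingham_tau lam tau r j).deriv

lemma fisherBinghamDerivTau_eq_zero (lam : Fin (n + 1) → ℝ) {tau : Fin (n + 1) → ℝ}
    {j : Fin (n + 1)} (hj : tau j = 0) (r : ℝ) : fisherBinghamDerivTau j lam tau r = 0 := by
  let e : EuclideanSpace ℝ (Fin (n + 1)) ≃ₗᵢ[ℝ] EuclideanSpace ℝ (Fin (n + 1)) :=
    LinearIsometryEquiv.piLpCongrRight 2 fun i =>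
      if i = j then LinearIsometryEquiv.neg ℝ else LinearIsometryEquiv.refl ℝ ℝ
  have he_self (t) : e t j = -t j := by simp [e]
  have he_ne {i} (hi : i ≠ j) (t) : e t i = t i := by simp [e, hi]
  have hsq (i t) : e t i ^ 2 = t i ^ 2 := by
    obtain rfl | hi := eq_or_ne i j
    · rw [he_self, neg_sq]
    · rw [he_ne hi]
  have hlin (i t) : tau i * e t i = tau i * t i := by
    obtain rfl | hi := eq_or_ne i j
    · rw [hj, zero_mul, zero_mul]
    · rw [he_ne hi]
  rw [fisherBinghamDerivTau_eq_integral]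
  refine integral_sphereSurfaceMeasure_eq_zero_of_odd r e fun t => ?_
  simp only [fisherBinghamDensity, he_self, hsq, hlin, neg_mul]

end Derivatives

section FisherBingham

open Filter Asymptotics Real

variable {n : ℕ} {lam tau : Fin (n + 1) → ℝ}

lemma integral_tangentDensity (h_top : ∀ j : Fin n, lam j.succ < lam 0) (tau : Fin (n + 1) → ℝ) :
    ∫ y, tangentDensity lam tau y =
      π ^ ((n : ℝ) / 2) / (∏ i : Fin n, (lam 0 - lam i.succ) ^ (1 / 2 : ℝ)) *
        exp (-∑ i : Fin n, tau i.succ ^ 2 / (4 * (lam i.succ - lam 0))) := by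
  unfold tangentDensity
  simp only [integral_fisherBinghamDensity (fun i => sub_neg.2 (h_top i)), Fintype.card_fin,
    neg_sub]

lemma integral_tangentDensity_pos (h_top : ∀ j : Fin n, lam j.succ < lam 0)
    (tau : Fin (n + 1) → ℝ) : 0 < ∫ y, tangentDensity lam tau y := by
  have hprod : 0 < ∏ i : Fin n, (lam 0 - lam i.succ) ^ (1 / 2 : ℝ) :=
    Finset.prod_pos fun i _ => rpow_pos_of_pos (sub_pos.2 (h_top i)) _
  rw [integral_tangentDensity h_top]
  positivity

lemma fisherBingham_isEquivalent_integral_tangentDensity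
    (h_top : ∀ j : Fin n, lam j.succ < lam 0) (tau : Fin (n + 1) → ℝ) :
    (fun r => fisherBingham lam tau r) ~[atTop] fun r =>
      exp (r ^ 2 * lam 0) *
        ((exp (r * tau 0) + exp (-(r * tau 0))) * ∫ y, tangentDensity lam tau y) := by
  have h := integral_mul_fisherBinghamDensity_isEquivalent (tau := tau) h_top (m := 0)
    (.inl .zero) (v := fun _ => 1) continuous_const (N := 0) (by simp)
    (by simpa using (integral_tangentDensity_pos h_top tau).ne')
  simpa only [pow_zero, one_mul, fisherBingham, fisherBinghamDensity] using h

theorem fisherBingham_isEquivalent (h_top : ∀ j : Fin n, lam j.succ < lam 0)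
    (tau : Fin (n + 1) → ℝ) :
    (fun r => fisherBingham lam tau r) ~[atTop] fun r =>
      π ^ ((n : ℝ) / 2) / (∏ i : Fin n, (lam 0 - lam i.succ) ^ (1 / 2 : ℝ)) *
        (exp (r * tau 0) + exp (-(r * tau 0))) *
        exp (r ^ 2 * lam 0 - ∑ i : Fin n, tau i.succ ^ 2 / (4 * (lam i.succ - lam 0))) := by
  convert fisherBingham_isEquivalent_integral_tangentDensity h_top tau using 2 with r
  rw [integral_tangentDensity h_top, sub_eq_add_neg, exp_add]
  ring

theorem integral_mul_fisherBinghamDensity_isEquivalent_fisherBingham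
    (h_top : ∀ j : Fin n, lam j.succ < lam 0) {m : ℕ} (hm : Even m ∨ tau 0 ≠ 0)
    {v : EuclideanSpace ℝ (Fin n) → ℝ} (hv : Continuous v) {N : ℕ}
    (hvN : ∀ y, |v y| ≤ (1 + ‖y‖ ^ 2) ^ N) {K : ℝ} (hK₀ : K ≠ 0)
    (hK : ∫ y, v y * tangentDensity lam tau y = K * ∫ y, tangentDensity lam tau y) :
    (fun r => ∫ t, t 0 ^ m * v (tailVec t) * fisherBinghamDensity lam tau t
      ∂(sphereSurfaceMeasure n r)) ~[atTop]
    fun r => r ^ m * ((exp (r * tau 0) + (-1) ^ m * exp (-(r * tau 0))) /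
      (exp (r * tau 0) + exp (-(r * tau 0)))) * K * fisherBingham lam tau r := by
  have hpos := integral_tangentDensity_pos h_top tau
  refine (integral_mul_fisherBinghamDensity_isEquivalent h_top hm hv hvN
    (hK ▸ mul_ne_zero hK₀ hpos.ne')).trans ?_
  refine (EventuallyEq.of_eq (funext fun r => ?_)).isEquivalent.trans
    (IsEquivalent.refl.mul (fisherBingham_isEquivalent_integral_tangentDensity h_top tau).symm)
  have hcosh : exp (r * tau 0) + exp (-(r * tau 0)) ≠ 0 := by positivity
  rw [hK, Pi.mul_apply]
  field_simp

theorem fisherBinghamDerivLam_zero_isEquivalent (h_top : ∀ j : Fin n, lam j.succ < lam 0)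
    (tau : Fin (n + 1) → ℝ) :
    (fun r => fisherBinghamDerivLam 0 lam tau r) ~[atTop]
      fun r => r ^ 2 * fisherBingham lam tau r := by
  have h := integral_mul_fisherBinghamDensity_isEquivalent_fisherBingham (tau := tau) h_top
    (.inl even_two) (v := fun _ => 1) continuous_const (N := 0) (by simp) one_ne_zero (by simp)
  convert h using 2 with r r
  · simp only [fisherBinghamDerivLam_eq_integral, mul_one]
  · have hcosh : exp (r * tau 0) + exp (-(r * tau 0)) ≠ 0 := by positivity
    rw [neg_one_sq, one_mul, div_self hcosh, mul_one, mul_one]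

theorem fisherBinghamDerivTau_zero_isEquivalent (h_top : ∀ j : Fin n, lam j.succ < lam 0)
    (tau : Fin (n + 1) → ℝ) :
    (fun r => fisherBinghamDerivTau 0 lam tau r) ~[atTop] fun r =>
      r * ((exp (r * tau 0) - exp (-(r * tau 0))) / (exp (r * tau 0) + exp (-(r * tau 0)))) *
        fisherBingham lam tau r := by
  obtain h₀ | h₀ := eq_or_ne (tau 0) 0
  · simp only [fisherBinghamDerivTau_eq_zero lam h₀, h₀, mul_zero, neg_zero, sub_self, zero_div,
      zero_mul]
    rfl
  have h := integral_mul_fisherBinghamDensity_isEquivalent_fisherBingham h_top (m := 1)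
    (.inr h₀) (v := fun _ => 1) continuous_const (N := 0) (by simp) one_ne_zero (by simp)
  convert h using 2 with r r
  · simp only [fisherBinghamDerivTau_eq_integral, pow_one, mul_one]
  · rw [pow_one, pow_one, neg_one_mul, mul_one, ← sub_eq_add_neg]

theorem integral_coord_succ_pow_mul_isEquivalent (h_top : ∀ j : Fin n, lam j.succ < lam 0)
    (j : Fin n) {k : ℕ} {K : ℝ} (hK₀ : K ≠ 0)
    (hK : ∫ x, x ^ k * exp ((lam j.succ - lam 0) * x ^ 2 + tau j.succ * x) =
      K * ∫ x, exp ((lam j.succ - lam 0) * x ^ 2 + tau j.succ * x)) :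
    (fun r => ∫ t, t j.succ ^ k * fisherBinghamDensity lam tau t ∂(sphereSurfaceMeasure n r))
      ~[atTop] fun r => K * fisherBingham lam tau r := by
  have hbound (y : EuclideanSpace ℝ (Fin n)) : |y j ^ k| ≤ (1 + ‖y‖ ^ 2) ^ k := by
    rw [abs_pow]
    gcongr
    have hcoord : |y j| ≤ ‖y‖ := PiLp.norm_apply_le y j
    nlinarith [sq_nonneg (‖y‖ - 1)]
  have h := integral_mul_fisherBinghamDensity_isEquivalent_fisherBingham h_top (.inl .zero)
    (v := fun y => y j ^ k) (by fun_prop) hbound hK₀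
    (integral_coord_mul_fisherBinghamDensity _ _ j hK)
  convert h using 2 with r r
  · simp only [pow_zero, one_mul, tailVec_apply]
  · have hcosh : exp (r * tau 0) + exp (-(r * tau 0)) ≠ 0 := by positivity
    rw [pow_zero, pow_zero, one_mul, one_mul, div_self hcosh, one_mul]

theorem fisherBinghamDerivLam_succ_isEquivalent (h_top : ∀ j : Fin n, lam j.succ < lam 0)
    (tau : Fin (n + 1) → ℝ) (j : Fin n) :
    (fun r => fisherBinghamDerivLam j.succ lam tau r) ~[atTop] fun r =>
      ((tau j.succ / (2 * (lam j.succ - lam 0))) ^ 2 + 1 / (2 * (lam 0 - lam j.succ))) *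
        fisherBingham lam tau r := by
  have hgap : 0 < lam 0 - lam j.succ := sub_pos.2 (h_top j)
  have hmoment := integral_sq_mul_exp_quadratic (sub_neg.2 (h_top j)) (tau j.succ)
  rw [neg_sub] at hmoment
  simpa only [fisherBinghamDerivLam_eq_integral] using
    integral_coord_succ_pow_mul_isEquivalent h_top j (by positivity) hmoment

theorem fisherBinghamDerivTau_succ_isEquivalent (h_top : ∀ j : Fin n, lam j.succ < lam 0)
    (tau : Fin (n + 1) → ℝ) (j : Fin n) :
    (fun r => fisherBinghamDerivTau j.succ lam tau r) ~[atTop] fun r =>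
      tau j.succ / (2 * (lam 0 - lam j.succ)) * fisherBingham lam tau r := by
  obtain h₀ | h₀ := eq_or_ne (tau j.succ) 0
  · simp only [fisherBinghamDerivTau_eq_zero lam h₀, h₀, zero_div, zero_mul]
    rfl
  have hgap : 0 < lam 0 - lam j.succ := sub_pos.2 (h_top j)
  have hmoment := integral_id_mul_exp_quadratic (sub_neg.2 (h_top j)) (tau j.succ)
  rw [neg_sub] at hmoment
  simpa only [fisherBinghamDerivTau_eq_integral, pow_one] using
    integral_coord_succ_pow_mul_isEquivalent h_top j (k := 1) (by positivity)
      (by simpa only [pow_one] using hmoment)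

end FisherBingham

open Filter Asymptotics in
theorem proposition1_general (n : ℕ) (lam tau : Fin (n + 1) → ℝ)
    (h_top : ∀ j : Fin n, lam j.succ < lam 0) :
    (∀ r : ℝ, 0 < r → ∀ j : Fin (n + 1),
      DifferentiableAt ℝ (fun x => fisherBingham (Function.update lam j x) tau r) (lam j) ∧
      DifferentiableAt ℝ (fun x => fisherBingham lam (Function.update tau j x) r) (tau j)) ∧
    (fun r : ℝ => fisherBingham lam tau r) ~[atTop]
      (fun r : ℝ => Real.pi ^ ((n : ℝ) / 2) / (∏ i : Fin n, (lam 0 - lam i.succ) ^ (1 / 2 : ℝ)) *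
        (Real.exp (r * tau 0) + Real.exp (-(r * tau 0))) *
        Real.exp (r ^ 2 * lam 0 - ∑ i : Fin n, tau i.succ ^ 2 / (4 * (lam i.succ - lam 0)))) ∧
    (fun r : ℝ => fisherBinghamDerivLam 0 lam tau r) ~[atTop]
      (fun r : ℝ => r ^ 2 * fisherBingham lam tau r) ∧
    (∀ j : Fin n, (fun r : ℝ => fisherBinghamDerivLam j.succ lam tau r) ~[atTop]
      (fun r : ℝ => ((tau j.succ / (2 * (lam j.succ - lam 0))) ^ 2 +
        1 / (2 * (lam 0 - lam j.succ))) * fisherBingham lam tau r)) ∧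
    (fun r : ℝ => fisherBinghamDerivTau 0 lam tau r) ~[atTop]
      (fun r : ℝ => r * ((Real.exp (r * tau 0) - Real.exp (-(r * tau 0))) /
        (Real.exp (r * tau 0) + Real.exp (-(r * tau 0)))) * fisherBingham lam tau r) ∧
    (∀ j : Fin n, (fun r : ℝ => fisherBinghamDerivTau j.succ lam tau r) ~[atTop]
      (fun r : ℝ => tau j.succ / (2 * (lam 0 - lam j.succ)) * fisherBingham lam tau r)) :=
  ⟨fun r _ j => ⟨(hasDerivAt_fisherBingham_lam lam tau r j).differentiableAt,
      (hasDerivAt_fisherBingham_tau lam tau r j).differentiableAt⟩,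
    fisherBingham_isEquivalent h_top tau, fisherBinghamDerivLam_zero_isEquivalent h_top tau,
    fisherBinghamDerivLam_succ_isEquivalent h_top tau,
    fisherBinghamDerivTau_zero_isEquivalent h_top tau,
    fisherBinghamDerivTau_succ_isEquivalent h_top tau⟩

open Filter Asymptotics in
theorem proposition1 (n : ℕ) (lam tau : Fin (n + 1) → ℝ)
    (h_neg : lam 0 < 0) (h_top : ∀ j : Fin n, lam j.succ < lam 0) (h_anti : Antitone lam) :
    -- the partial derivatives exist
    (∀ r : ℝ, 0 < r → ∀ j : Fin (n + 1),
      DifferentiableAt ℝ (fun x => fisherBingham (Function.update lam j x) tau r) (lam j) ∧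
      DifferentiableAt ℝ (fun x => fisherBingham lam (Function.update tau j x) r) (tau j)) ∧
    (fun r : ℝ => fisherBingham lam tau r) ~[atTop]
      (fun r : ℝ => Real.pi ^ ((n : ℝ) / 2) / (∏ i : Fin n, (lam 0 - lam i.succ) ^ (1 / 2 : ℝ)) *
        (Real.exp (r * tau 0) + Real.exp (-(r * tau 0))) *
        Real.exp (r ^ 2 * lam 0 - ∑ i : Fin n, tau i.succ ^ 2 / (4 * (lam i.succ - lam 0)))) ∧
    (fun r : ℝ => fisherBinghamDerivLam 0 lam tau r) ~[atTop]
      (fun r : ℝ => r ^ 2 * fisherBingham lam tau r) ∧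
    (∀ j : Fin n, (fun r : ℝ => fisherBinghamDerivLam j.succ lam tau r) ~[atTop]
      (fun r : ℝ => ((tau j.succ / (2 * (lam j.succ - lam 0))) ^ 2 +
        1 / (2 * (lam 0 - lam j.succ))) * fisherBingham lam tau r)) ∧
    (fun r : ℝ => fisherBinghamDerivTau 0 lam tau r) ~[atTop]
      (fun r : ℝ => r * ((Real.exp (r * tau 0) - Real.exp (-(r * tau 0))) /
        (Real.exp (r * tau 0) + Real.exp (-(r * tau 0)))) * fisherBingham lam tau r) ∧
    (∀ j : Fin n, (fun r : ℝ => fisherBinghamDerivTau j.succ lam tau r) ~[atTop]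
      (fun r : ℝ => tau j.succ / (2 * (lam 0 - lam j.succ)) * fisherBingham lam tau r)) :=
  proposition1_general n lam tau h_top
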